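/- Let $a_i,b_j\in[0,1]$ $(i,j\ge 1)$ with $0<a_ib_j<1$ for all $i,j$, and let $\omega(i,j)$, $i,j\ge 1$, be independent random variables with $\mathbf P(\omega(i,j)=k)=(1-a_ib_j)(a_ib_j)^k$, $k=0,1,2,\dots$. Let $N\ge 1$ and $m\ge 0$ be integers, let $x\in\mathbb W_N=\{x\in\mathbb Z^N: x_1\le x_2\le\dots\le x_N\}$, and define $G$ for $1\le n\le N$ by $G(0,n)=x_n$ and $$G(m',n)=\max\{G(m'-1,n),\,G(m',n-1)\}+\omega(m',n)\qquad(m',n\ge 1),$$ with boundary value $G(m',0)=c$ for all $m'\geq 1$, where $c$ is any integer with $c\le x_1$ (for instance $c=0$ if $x_1\ge 0$; the choice of $c$ does not matter, and amounts to $G(m',0)=-\infty$). Let $0=n_0<n_1<\dots<n_p=N$ and let $h_1\le h_2\le\dots\le h_p$ be integers. Set $h(j)=h_k$ for every $j\in(n_{k-1},n_k]$. Then, for every $R>\max\{1/b_1,\dots,1/b_N\}$, $$\mathbf P\big(G(m,n_1)<h_1,\;G(m,n_2)<h_2,\;\dots,\;G(m,n_p)<h_p\big)=\det\big[F(i,j\,|\,x)\big]_{1\le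 i,j\le N},$$ where $$F(i,j\,|\,x)=\frac{1}{2\pi \mathbf i}\oint_{|z|=R}dz\,\frac{(zb_j)^{h(j)-1}}{(zb_i)^{x_i}}\;\frac{\prod_{k=1}^{j-1}(z-1/b_k)}{\prod_{k=1}^{i}(z-1/b_k)}\;\prod_{k=1}^m\frac{1-a_kb_j}{1-a_k/z},$$ the circle being oriented counter-clockwise. (Since $G(m,n)$ is nondecreasing in $n$, replacing each $h_k$ by $\min_{l\ge k}h_l$ does not change the event, so the assumption $h_1\le\dots\le h_p$ loses no probabilities.) -/

import Mathlib

open MeasureTheory ProbabilityTheory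

namespace PNG

/-- Admissible rates: all `a i, b j` (indices `≥ 1`) lie in `[0,1]` and `0 < a i * b j < 1`. -/
structure AdmissibleRates (a b : ℕ → ℝ) : Prop where
  a_mem : ∀ i, 1 ≤ i → a i ∈ Set.Icc (0 : ℝ) 1
  b_mem : ∀ j, 1 ≤ j → b j ∈ Set.Icc (0 : ℝ) 1
  pos : ∀ i j, 1 ≤ i → 1 ≤ j → 0 < a i * b j
  lt_one : ∀ i j, 1 ≤ i → 1 ≤ j → a i * b j < 1

/-- The random environment: the weights `ω i j`, `i, j ≥ 1`, are independent random variables with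
`P(ω i j = k) = (1 - a i * b j) * (a i * b j) ^ k` for `k = 0, 1, 2, …`. -/
structure IsGeometricEnvironment {Ω : Type*} [MeasurableSpace Ω] (μ : Measure Ω)
    (a b : ℕ → ℝ) (ω : ℕ → ℕ → Ω → ℕ) : Prop where
  measurable : ∀ i j, 1 ≤ i → 1 ≤ j → Measurable (ω i j)
  indep : iIndepFun (fun (q : ℕ+ × ℕ+) => ω (q.1 : ℕ) (q.2 : ℕ)) μ
  law : ∀ i j, 1 ≤ i → 1 ≤ j → ∀ k : ℕ,
    μ.real {s | ω i j s = k} = (1 - a i * b j) * (a i * b j) ^ k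

/-- The growth function of an array of weights `w i j`, `i, j ≥ 1`, with initial condition
`G(0, n) = x n` for `n ≥ 1` and boundary value `G(m, 0) = c`:
`G(m, n) = max (G(m-1, n)) (G(m, n-1)) + w m n` for `m, n ≥ 1`. -/
def growth (c : ℤ) (x : ℕ → ℤ) (w : ℕ → ℕ → ℕ) : ℕ → ℕ → ℤ
  | _, 0 => c
  | 0, n + 1 => x (n + 1)
  | m + 1, n + 1 =>
      max (growth c x w m (n + 1)) (growth c x w (m + 1) n) + (w (m + 1) (n + 1) : ℤ)

/-- The step function with value `h_k` on `(n_{k-1}, n_k]`, `k = 1, …, p`. Here `h_k` is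
`h` at the `k`-th element of `Fin p`, and `0` is a default value outside `(n_0, n_p]`. -/
def blockHeight {p : ℕ} (n : Fin (p + 1) → ℕ) (h : Fin p → ℤ) (j : ℕ) : ℤ :=
  ∑ k : Fin p, if n k.castSucc < j ∧ j ≤ n k.succ then h k else 0

/-- The integrand of the entry `(i, j)`, with `H` the step function of the heights. -/
noncomputable def integrand (a b : ℕ → ℝ) (m : ℕ) (x H : ℕ → ℤ) (i j : ℕ) (z : ℂ) : ℂ :=
  (z * (b j : ℂ)) ^ (H j - 1) / (z * (b i : ℂ)) ^ (x i)
    * ((∏ k ∈ Finset.Icc 1 (j - 1), (z - 1 / (b k : ℂ)))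
        / ∏ k ∈ Finset.Icc 1 i, (z - 1 / (b k : ℂ)))
    * ∏ k ∈ Finset.Icc 1 m, (1 - (a k : ℂ) * (b j : ℂ)) / (1 - (a k : ℂ) / z)

/-- The entry `F(i, j | x)`: the contour integral over the counter-clockwise circle `|z| = R`. -/
noncomputable def entry (a b : ℕ → ℝ) (m : ℕ) (x H : ℕ → ℤ) (R : ℝ) (i j : ℕ) : ℂ :=
  (1 / (2 * (Real.pi : ℂ) * Complex.I)) * ∮ z in C(0, R), integrand a b m x H i j z

/-- The `N × N` matrix `F`; the element `i` of `Fin N` stands for the row or column `i + 1`. -/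
noncomputable def matrixF (a b : ℕ → ℝ) (m N : ℕ) (x H : ℕ → ℤ) (R : ℝ) :
    Matrix (Fin N) (Fin N) ℂ :=
  Matrix.of fun i j => entry a b m x H R ((i : ℕ) + 1) ((j : ℕ) + 1)

end PNG

/-! A determinant whose rows follow the growth model is a martingale. To each time `l`, row `i` and
position `u` corresponds a vector `profile l i u`, indexed by the columns `j`. Its entries are
contour integrals in which the test function has lost the factors `1 - a k / z` with `k ≤ l`.
Consider the determinant with rows `profile l i (G(l, i))`. At time 0 it is the determinant of `F`,
up to a diagonal conjugation (`det_matrixF_eq`). At time `m` it is the indicator of the event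
(`det_profile_self`). Constancy of its expectation gives the formula.

The martingale property uses only `IsRowSystem`. The relation `geometric` is the one-row equation
for averaging over a geometric jump. The relation `sub_one` handles the maximum: when a row is
pushed up by its predecessor, its change is a multiple of that predecessor, invisible to the
determinant.

Weights are integrated out one cell at a time. Halfway through time `l + 1`, after `n` cells, the
remaining rows are still at time `l` but sit at `max (G(l+1, n)) (G(l, i))`: they have already felt
the push. Averaging over the next weight is then a telescoping sum (`hasSum_det_updateRow`), and
independence turns it into an identity of expectations. -/

namespace PNG

/-! ### Contour integrals and their recursions in position -/

open Filter Topology in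
/-- A contour integral vanishes when the integrand has no singularity on or outside the contour
and is `o(1 / z)` at infinity. -/
theorem circleIntegral_eq_zero_of_decay {R : ℝ} (hR : 0 < R) {f : ℂ → ℂ}
    (hf : ∀ z, R ≤ ‖z‖ → DifferentiableAt ℂ f z)
    (hlim : Tendsto (fun z => z * f z) (Bornology.cobounded ℂ) (𝓝 0)) :
    ∮ z in C(0, R), f z = 0 := by
  rw [← norm_le_zero_iff]
  refine le_of_forall_pos_le_add fun ε hε => ?_
  -- On a circle of radius `ρ` the integrand will be at most `ε / (2πρ)` and the length is `2πρ`, so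
  -- the bound `ε` does not depend on `ρ`.
  have hε' : 0 < ε / (2 * Real.pi) := by positivity
  obtain ⟨r, -, hr⟩ := hasBasis_cobounded_norm.mem_iff.1 (Metric.tendsto_nhds.1 hlim _ hε')
  set ρ := max R r with hρ
  have hρ0 : 0 < ρ := hR.trans_le (le_max_left _ _)
  have hann := Complex.circleIntegral_eq_of_differentiable_on_annulus_off_countable (c := 0) hR
    (le_max_left R r) (f := f) Set.countable_empty
    (fun z hz => (hf z (by simpa using hz.2)).continuousAt.continuousWithinAt)
    (fun z hz => hf z (le_of_lt (by simpa using hz.1.2)))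
  rw [← hann, zero_add]
  refine (circleIntegral.norm_integral_le_of_norm_le_const hρ0.le
    (C := ε / (2 * Real.pi) / ρ) fun z hz => ?_).trans_eq ?_
  · rw [mem_sphere_zero_iff_norm] at hz
    have : dist (z * f z) 0 < ε / (2 * Real.pi) := hr (hz.ge.trans' (le_max_right _ _))
    rw [dist_zero_right, norm_mul, hz] at this
    rw [le_div_iff₀ hρ0, mul_comm]
    exact this.le
  · field_simp

/-- The contour integral defining row `i` with position `x`, against the test function `g`. -/
noncomputable def contourRow (b : ℕ → ℝ) (R : ℝ) (g : ℂ → ℂ) (i : ℕ) (x : ℤ) : ℂ :=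
  ∮ z in C(0, R), (z * (b i : ℂ)) ^ (-x) / (∏ k ∈ Finset.Icc 1 i, (z - 1 / (b k : ℂ))) * g z

/-- The circle of radius `R` encloses all the points `1 / b k`, `1 ≤ k ≤ N`. -/
structure Encloses (b : ℕ → ℝ) (N : ℕ) (R : ℝ) : Prop where
  radius_pos : 0 < R
  pos : ∀ k, 1 ≤ k → k ≤ N → 0 < b k
  lt : ∀ k, 1 ≤ k → k ≤ N → 1 / b k < R

section

variable {b : ℕ → ℝ} {N : ℕ} {R : ℝ}

theorem Encloses.ofReal_ne_zero (hb : Encloses b N R) {k : ℕ} (h1 : 1 ≤ k) (hk : k ≤ N) :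
    (b k : ℂ) ≠ 0 :=
  Complex.ofReal_ne_zero.2 (hb.pos k h1 hk).ne'

theorem Encloses.ne_zero (hb : Encloses b N R) {z : ℂ} (hz : R ≤ ‖z‖) : z ≠ 0 :=
  norm_pos_iff.1 (hb.radius_pos.trans_le hz)

theorem Encloses.norm_inv_lt (hb : Encloses b N R) {k : ℕ} (h1 : 1 ≤ k) (hk : k ≤ N) :
    ‖(1 / (b k : ℂ))‖ < R := by
  have := hb.pos k h1 hk
  rw [norm_div, Complex.norm_real, Real.norm_of_nonneg this.le, norm_one]
  exact hb.lt k h1 hk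

theorem Encloses.sub_ne_zero (hb : Encloses b N R) {z : ℂ} (hz : R ≤ ‖z‖) {k : ℕ} (h1 : 1 ≤ k)
    (hk : k ≤ N) : z - 1 / (b k : ℂ) ≠ 0 := by
  intro h
  rw [_root_.sub_eq_zero] at h
  have := hb.norm_inv_lt h1 hk
  rw [← h] at this
  exact this.not_ge hz

theorem Encloses.prod_ne_zero (hb : Encloses b N R) {z : ℂ} (hz : R ≤ ‖z‖) {i : ℕ}
    (hi : i ≤ N) : ∏ k ∈ Finset.Icc 1 i, (z - 1 / (b k : ℂ)) ≠ 0 := by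
  refine Finset.prod_ne_zero_iff.2 fun k hk => ?_
  rw [Finset.mem_Icc] at hk
  exact hb.sub_ne_zero hz hk.1 (hk.2.trans hi)

theorem Encloses.one_lt (hb : Encloses b N R) {k : ℕ} (h1 : 1 ≤ k) (hk : k ≤ N) :
    1 < R * b k := by
  have := hb.lt k h1 hk
  rwa [div_lt_iff₀ (hb.pos k h1 hk)] at this

theorem continuousOn_rowFactor (hb : Encloses b N R) {i : ℕ} (h1 : 1 ≤ i) (hi : i ≤ N) (x : ℤ) :
    ContinuousOn (fun z : ℂ => (z * (b i : ℂ)) ^ (-x) / ∏ k ∈ Finset.Icc 1 i, (z - 1 / (b k : ℂ)))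
      (Metric.sphere 0 R) := by
  have hs : ∀ z ∈ Metric.sphere (0 : ℂ) R, R ≤ ‖z‖ := fun z hz => by
    rw [mem_sphere_zero_iff_norm] at hz; exact hz.ge
  refine ContinuousOn.div ?_ ?_ fun z hz => hb.prod_ne_zero (hs z hz) hi
  · exact ContinuousOn.zpow₀ (by fun_prop) _ fun z hz =>
      Or.inl (mul_ne_zero (hb.ne_zero (hs z hz)) (hb.ofReal_ne_zero h1 hi))
  · fun_prop

theorem circleIntegrable_row (hb : Encloses b N R) {i : ℕ} (h1 : 1 ≤ i) (hi : i ≤ N) (x : ℤ)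
    {g : ℂ → ℂ} (hg : ContinuousOn g (Metric.sphere 0 R)) :
    CircleIntegrable (fun z : ℂ => (z * (b i : ℂ)) ^ (-x) /
      (∏ k ∈ Finset.Icc 1 i, (z - 1 / (b k : ℂ))) * g z) 0 R :=
  ((continuousOn_rowFactor hb h1 hi x).mul hg).circleIntegrable hb.radius_pos.le

/-- Lowering the position in a row adds a multiple of the previous row. -/
theorem contourRow_sub_one (hb : Encloses b N R) {i : ℕ} (h1 : 1 ≤ i) (hi : i + 1 ≤ N) (u : ℤ)
    {g : ℂ → ℂ} (hg : ContinuousOn g (Metric.sphere 0 R)) :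
    contourRow b R g (i + 1) (u - 1) = contourRow b R g (i + 1) u
      + (b (i + 1) : ℂ) * ((b i : ℂ) / b (i + 1)) ^ u * contourRow b R g i u := by
  rw [← sub_eq_iff_eq_add']
  unfold contourRow
  rw [← circleIntegral.integral_sub (circleIntegrable_row hb (by omega) hi _ hg)
    (circleIntegrable_row hb (by omega) hi _ hg), ← circleIntegral.integral_const_mul]
  refine circleIntegral.integral_congr hb.radius_pos.le fun z hz => ?_
  have hz' : R ≤ ‖z‖ := by rw [mem_sphere_zero_iff_norm] at hz; exact hz.ge
  have hz0 := hb.ne_zero hz'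
  have hbi := hb.ofReal_ne_zero h1 (by omega)
  have hbi1 := hb.ofReal_ne_zero (k := i + 1) (by omega) hi
  have hP := hb.prod_ne_zero hz' (i := i) (by omega)
  have hs := hb.sub_ne_zero hz' (k := i + 1) (by omega) hi
  have e1 : (z * (b (i + 1) : ℂ)) ^ (-(u - 1)) = (z * b (i + 1)) * (z * b (i + 1)) ^ (-u) := by
    rw [show -(u - 1) = 1 + -u by ring, zpow_add₀ (mul_ne_zero hz0 hbi1), zpow_one]
  have e2 : ((b i : ℂ) / b (i + 1)) ^ u * (z * b i) ^ (-u) = (z * b (i + 1)) ^ (-u) := by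
    rw [div_zpow, mul_zpow, mul_zpow, zpow_neg, zpow_neg, zpow_neg]
    have := zpow_ne_zero u hbi
    field_simp
  -- The difference of the two integrands carries this factor, which cancels the last factor of the
  -- denominator and leaves row `i`.
  have e3 : z * b (i + 1) - 1 = b (i + 1) * (z - 1 / (b (i + 1) : ℂ)) := by field_simp
  rw [Finset.prod_Icc_succ_top (by omega), e1]
  calc _ = (z * (b (i + 1) : ℂ)) ^ (-u) * (z * b (i + 1) - 1) /
        ((∏ k ∈ Finset.Icc 1 i, (z - 1 / (b k : ℂ))) * (z - 1 / (b (i + 1) : ℂ))) * g z := by ring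
    _ = _ := by
      rw [e3, ← e2]
      generalize z - 1 / (b (i + 1) : ℂ) = s at *
      field_simp

/-- Summation by parts against a geometric weight divides the test function by `1 - a / z`. -/
theorem contourRow_geometric (hb : Encloses b N R) {i : ℕ} (h1 : 1 ≤ i) (hi : i ≤ N) (u : ℤ)
    (a : ℂ) {g g' : ℂ → ℂ} (hg' : ContinuousOn g' (Metric.sphere 0 R))
    (h : ∀ z ∈ Metric.sphere (0 : ℂ) R, g z = (1 - a / z) * g' z) :
    contourRow b R g' i u - a * b i * contourRow b R g' i (u + 1) = contourRow b R g i u := by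
  unfold contourRow
  rw [← circleIntegral.integral_const_mul, ← circleIntegral.integral_sub
    (circleIntegrable_row hb h1 hi _ hg')]
  · refine circleIntegral.integral_congr hb.radius_pos.le fun z hz => ?_
    have hz' : R ≤ ‖z‖ := by rw [mem_sphere_zero_iff_norm] at hz; exact hz.ge
    have hz0 := hb.ne_zero hz'
    have hbi := hb.ofReal_ne_zero h1 hi
    rw [h z hz, neg_add, zpow_add₀ (mul_ne_zero hz0 hbi), zpow_neg_one]
    field_simp
  · have := circleIntegrable_row hb h1 hi (u + 1) hg'
    exact this.const_smul (a := a * b i)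

/-- On the contour `‖z * b i‖ = R * b i > 1`, so the integrand is largest at the lowest position
`c`. This bound makes the geometric series converge and the determinants integrable. -/
theorem exists_norm_contourRow_le (hb : Encloses b N R) {i : ℕ} (h1 : 1 ≤ i) (hi : i ≤ N) (c : ℤ)
    {g : ℂ → ℂ} (hg : ContinuousOn g (Metric.sphere 0 R)) :
    ∃ C, ∀ u, c ≤ u → ‖contourRow b R g i u‖ ≤ C := by
  obtain ⟨C, hC⟩ := (isCompact_sphere (0 : ℂ) R).exists_bound_of_continuousOn
    ((continuousOn_rowFactor hb h1 hi c).mul hg)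
  refine ⟨2 * Real.pi * R * C, fun u hu =>
    circleIntegral.norm_integral_le_of_norm_le_const hb.radius_pos.le fun z hz => ?_⟩
  refine le_trans ?_ (hC z hz)
  have hzb : 1 ≤ ‖z * (b i : ℂ)‖ := by
    rw [mem_sphere_zero_iff_norm] at hz
    rw [norm_mul, hz, Complex.norm_real, Real.norm_of_nonneg (hb.pos i h1 hi).le]
    exact (hb.one_lt h1 hi).le
  rw [Pi.mul_apply, norm_mul _ (g z), norm_mul _ (g z), norm_div, norm_div, norm_zpow, norm_zpow]
  have := zpow_le_zpow_right₀ hzb (neg_le_neg hu)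
  gcongr

/-! ### Test functions and their integrals at the final time -/

/-- The test function of column `j` at time `l`. -/
noncomputable def testFun (a b : ℕ → ℝ) (m : ℕ) (H : ℕ → ℤ) (l j : ℕ) (z : ℂ) : ℂ :=
  (z * (b j : ℂ)) ^ (H j - 1) * (∏ k ∈ Finset.Icc 1 (j - 1), (z - 1 / (b k : ℂ)))
    * ∏ k ∈ Finset.Ioc l m, (1 - (a k : ℂ) / z)⁻¹

/-- All poles cancel: the product up to `j - 1` contains the denominator, and `x < H j` makes the
power of `z` nonnegative, so the integrand agrees with a polynomial on the circle. -/
theorem contourRow_testFun_of_gt (hb : Encloses b N R) (a : ℕ → ℝ) (m : ℕ) {H : ℕ → ℤ} {x : ℤ}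
    {i j : ℕ} (h1 : 1 ≤ i) (hij : i < j) (hj : j ≤ N) (hx : x < H j) :
    contourRow b R (testFun a b m H m j) i x = 0 := by
  obtain ⟨e, he⟩ := Int.eq_ofNat_of_zero_le (show 0 ≤ H j - 1 - x by omega)
  have hbi := hb.ofReal_ne_zero h1 (by omega)
  have hbj := hb.ofReal_ne_zero (k := j) (by omega) hj
  calc contourRow b R (testFun a b m H m j) i x
      = ∮ z in C(0, R), (b j : ℂ) ^ (H j - 1) * (b i : ℂ) ^ (-x) * z ^ e
          * ∏ k ∈ Finset.Ioc i (j - 1), (z - 1 / (b k : ℂ)) := by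
        refine circleIntegral.integral_congr hb.radius_pos.le fun z hz => ?_
        have hz' : R ≤ ‖z‖ := by rw [mem_sphere_zero_iff_norm] at hz; exact hz.ge
        have hz0 := hb.ne_zero hz'
        have hP := hb.prod_ne_zero hz' (i := i) (by omega)
        have hsplit : ∏ k ∈ Finset.Icc 1 (j - 1), (z - 1 / (b k : ℂ))
            = (∏ k ∈ Finset.Icc 1 i, (z - 1 / (b k : ℂ)))
              * ∏ k ∈ Finset.Ioc i (j - 1), (z - 1 / (b k : ℂ)) := by
          rw [← Finset.prod_union]
          · congr 1
            ext k; simp only [Finset.mem_union, Finset.mem_Icc, Finset.mem_Ioc]; omega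
          · rw [Finset.disjoint_left]
            intro k; simp only [Finset.mem_Icc, Finset.mem_Ioc]; omega
        have hpow : z ^ (-x) * z ^ (H j - 1) = z ^ e := by
          rw [← zpow_add₀ hz0, ← zpow_natCast]; congr 1; omega
        simp only [testFun, Finset.Ioc_self, Finset.prod_empty, mul_one]
        rw [hsplit, mul_zpow, mul_zpow, ← hpow]
        field_simp
    _ = 0 := Complex.circleIntegral_eq_zero_of_differentiable_on_off_countable hb.radius_pos.le
        Set.countable_empty (by fun_prop) (fun z _ => by fun_prop)

/-- Only the simple pole at `1 / b i` survives, and there the remaining power of `z * b i` equals 1.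
-/
theorem contourRow_testFun_self (hb : Encloses b N R) (a : ℕ → ℝ) (m : ℕ) {H : ℕ → ℤ} {x : ℤ}
    {i : ℕ} (h1 : 1 ≤ i) (hi : i ≤ N) (hx : x < H i) :
    contourRow b R (testFun a b m H m i) i x = 2 * Real.pi * Complex.I := by
  obtain ⟨e, he⟩ := Int.eq_ofNat_of_zero_le (show 0 ≤ H i - 1 - x by omega)
  have hbi := hb.ofReal_ne_zero h1 hi
  calc contourRow b R (testFun a b m H m i) i x
      = ∮ z in C(0, R), (z - 1 / (b i : ℂ))⁻¹ • (z * (b i : ℂ)) ^ e := by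
        refine circleIntegral.integral_congr hb.radius_pos.le fun z hz => ?_
        have hz' : R ≤ ‖z‖ := by rw [mem_sphere_zero_iff_norm] at hz; exact hz.ge
        have hz0 := hb.ne_zero hz'
        have hP := hb.prod_ne_zero hz' (i := i - 1) (by omega)
        have hs := hb.sub_ne_zero hz' h1 hi
        have hsplit : ∏ k ∈ Finset.Icc 1 i, (z - 1 / (b k : ℂ))
            = (∏ k ∈ Finset.Icc 1 (i - 1), (z - 1 / (b k : ℂ))) * (z - 1 / (b i : ℂ)) := by
          obtain ⟨i, rfl⟩ := Nat.exists_eq_add_of_le' h1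
          rw [Finset.prod_Icc_succ_top (by omega), Nat.add_sub_cancel]
        have hpow : (z * (b i : ℂ)) ^ (-x) * (z * (b i : ℂ)) ^ (H i - 1)
            = (z * (b i : ℂ)) ^ e := by
          rw [← zpow_add₀ (mul_ne_zero hz0 hbi), ← zpow_natCast]; congr 1; omega
        simp only [testFun, Finset.Ioc_self, Finset.prod_empty, mul_one, smul_eq_mul]
        rw [hsplit, ← hpow]
        generalize z - 1 / (b i : ℂ) = s at *
        field_simp
    _ = 2 * Real.pi * Complex.I := by
        rw [Complex.circleIntegral_sub_inv_smul_of_differentiable_on_off_countable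
          Set.countable_empty (by rw [mem_ball_zero_iff]; exact hb.norm_inv_lt h1 hi)
          (by fun_prop) (fun z _ => by fun_prop)]
        rw [one_div_mul_cancel hbi, one_pow, smul_eq_mul, mul_one]

-- The contour is pushed to infinity. After multiplication by `z` the integrand is a constant times
-- `z⁻¹ ^ (x - H j)` and the factors `(z - 1 / b k)⁻¹` for `j ≤ k ≤ i`; at least one such factor is
-- present, which gives the decay.
open Filter Topology in
theorem contourRow_testFun_of_le (hb : Encloses b N R) (a : ℕ → ℝ) (m : ℕ) {H : ℕ → ℤ} {x : ℤ}
    {i j : ℕ} (h1 : 1 ≤ j) (hij : j ≤ i) (hi : i ≤ N) (hx : H j ≤ x) :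
    contourRow b R (testFun a b m H m j) i x = 0 := by
  obtain ⟨e, he⟩ := Int.eq_ofNat_of_zero_le (show 0 ≤ x - H j by omega)
  have hbi := hb.ofReal_ne_zero (k := i) (by omega) hi
  have hbj := hb.ofReal_ne_zero h1 (by omega)
  refine circleIntegral_eq_zero_of_decay hb.radius_pos (fun z hz => ?_) ?_
  · have hz0 := hb.ne_zero hz
    simp only [testFun, Finset.Ioc_self, Finset.prod_empty, mul_one]
    have d1 : DifferentiableAt ℂ (fun z : ℂ => (z * (b i : ℂ)) ^ (-x)) z :=
      DifferentiableAt.zpow (by fun_prop) (Or.inl (mul_ne_zero hz0 hbi))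
    have d2 : DifferentiableAt ℂ (fun z : ℂ => (z * (b j : ℂ)) ^ (H j - 1)) z :=
      DifferentiableAt.zpow (by fun_prop) (Or.inl (mul_ne_zero hz0 hbj))
    exact (d1.div (by fun_prop) (hb.prod_ne_zero hz hi)).mul (d2.mul (by fun_prop))
  · have hlim : Tendsto (fun z : ℂ => (b j : ℂ) ^ (H j - 1) * (b i : ℂ) ^ (-x) * (z⁻¹) ^ e
          * ∏ k ∈ Finset.Icc j i, (z - 1 / (b k : ℂ))⁻¹) (Bornology.cobounded ℂ)
        (𝓝 ((b j : ℂ) ^ (H j - 1) * (b i : ℂ) ^ (-x) * 0 ^ e * ∏ k ∈ Finset.Icc j i, 0)) := by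
      refine ((tendsto_inv₀_cobounded.pow e).const_mul _).mul
        (tendsto_finsetProd _ fun k _ => ?_)
      refine tendsto_inv₀_cobounded.comp ?_
      exact tendsto_sub_const_cobounded _
    rw [Finset.prod_eq_zero (Finset.left_mem_Icc.2 hij) rfl, mul_zero] at hlim
    refine hlim.congr' ?_
    filter_upwards [eventually_cobounded_le_norm R] with z hz
    have hz0 := hb.ne_zero hz
    have hP := hb.prod_ne_zero hz (i := j - 1) (by omega)
    have hQ : ∏ k ∈ Finset.Icc j i, (z - 1 / (b k : ℂ)) ≠ 0 :=
      Finset.prod_ne_zero_iff.2 fun k hk => by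
        rw [Finset.mem_Icc] at hk
        exact hb.sub_ne_zero hz (by omega) (by omega)
    have hsplit : ∏ k ∈ Finset.Icc 1 i, (z - 1 / (b k : ℂ))
        = (∏ k ∈ Finset.Icc 1 (j - 1), (z - 1 / (b k : ℂ)))
          * ∏ k ∈ Finset.Icc j i, (z - 1 / (b k : ℂ)) := by
      rw [← Finset.prod_union]
      · congr 1
        ext k; simp only [Finset.mem_union, Finset.mem_Icc]; omega
      · rw [Finset.disjoint_left]
        intro k; simp only [Finset.mem_Icc]; omega
    have hpow : z * (z ^ (-x) * z ^ (H j - 1)) = (z⁻¹) ^ e := by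
      rw [← zpow_add₀ hz0, ← zpow_one_add₀ hz0, ← zpow_natCast, inv_zpow']; congr 1; omega
    simp only [testFun, Finset.Ioc_self, Finset.prod_empty, mul_one]
    rw [hsplit, Finset.prod_inv_distrib, mul_zpow, mul_zpow, ← hpow]
    field_simp

theorem one_sub_div_ne_zero {a : ℝ} (ha : |a| < R) {z : ℂ} (hz : R ≤ ‖z‖) :
    1 - (a : ℂ) / z ≠ 0 := by
  have hz0 : z ≠ 0 := norm_pos_iff.1 (((abs_nonneg a).trans_lt ha).trans_le hz)
  intro h
  rw [sub_eq_zero, eq_div_iff hz0, one_mul] at h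
  rw [h, Complex.norm_real, Real.norm_eq_abs] at hz
  exact ha.not_ge hz

theorem Ioc_eq_insert_succ {l m : ℕ} (hl : l < m) :
    Finset.Ioc l m = insert (l + 1) (Finset.Ioc (l + 1) m) := by
  ext k; simp only [Finset.mem_insert, Finset.mem_Ioc]; omega

theorem testFun_succ {a : ℕ → ℝ} {m l j : ℕ} (hl : l < m)
    (ha : |a (l + 1)| < R) (H : ℕ → ℤ) {z : ℂ} (hz : R ≤ ‖z‖) :
    testFun a b m H (l + 1) j z = (1 - (a (l + 1) : ℂ) / z) * testFun a b m H l j z := by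
  have := one_sub_div_ne_zero ha hz
  unfold testFun
  rw [Ioc_eq_insert_succ hl, Finset.prod_insert (by simp)]
  field_simp

theorem continuousOn_testFun (hb : Encloses b N R) {a : ℕ → ℝ} {m l j : ℕ} (h1 : 1 ≤ j)
    (hj : j ≤ N) (ha : ∀ k, 1 ≤ k → |a k| < R) (H : ℕ → ℤ) :
    ContinuousOn (testFun a b m H l j) (Metric.sphere 0 R) := by
  have hs : ∀ z ∈ Metric.sphere (0 : ℂ) R, R ≤ ‖z‖ := fun z hz => by
    rw [mem_sphere_zero_iff_norm] at hz; exact hz.ge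
  refine ContinuousOn.mul (ContinuousOn.mul ?_ (by fun_prop))
    (continuousOn_finsetProd _ fun k hk => ContinuousOn.inv₀ ?_ fun z hz => ?_)
  · exact ContinuousOn.zpow₀ (by fun_prop) _ fun z hz =>
      Or.inl (mul_ne_zero (hb.ne_zero (hs z hz)) (hb.ofReal_ne_zero h1 hj))
  · exact continuousOn_const.sub (continuousOn_const.div continuousOn_id fun z hz =>
      hb.ne_zero (hs z hz))
  · exact one_sub_div_ne_zero (ha k (by rw [Finset.mem_Ioc] at hk; omega)) (hs z hz)

end

/-! ### Row systems -/

/-- The row of index `i` at time `l` with position `u`, normalized by the rates of that row. -/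
noncomputable def profile (a b : ℕ → ℝ) (m : ℕ) (H : ℕ → ℤ) (R : ℝ) (N l i : ℕ) (u : ℤ)
    (j : Fin N) : ℂ :=
  (1 / (2 * (Real.pi : ℂ) * Complex.I)) * (∏ k ∈ Finset.Ioc l m, (1 - (a k : ℂ) * b i))
    * contourRow b R (testFun a b m H l (j + 1)) i u

/-- Families of row vectors `f l i u` (time `l`, row `i`, position `u`) for which a determinant
with rows `f l i (G(l, i))` is a martingale of the growth model with rates `q l i`. -/
structure IsRowSystem (N m : ℕ) (q : ℕ → ℕ → ℝ) (c : ℤ) (f : ℕ → ℕ → ℤ → Fin N → ℂ) : Prop where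
  sub_one : ∀ l ≤ m, ∀ i, 1 ≤ i → i + 1 ≤ N → ∀ u, ∃ r : ℂ,
    f l (i + 1) (u - 1) = f l (i + 1) u + r • f l i u
  geometric : ∀ l < m, ∀ i, 1 ≤ i → i ≤ N → ∀ u,
    f l i u - (q (l + 1) i : ℂ) • f l i (u + 1) = (1 - (q (l + 1) i : ℂ)) • f (l + 1) i u
  bounded : ∃ C, ∀ l ≤ m, ∀ i, 1 ≤ i → i ≤ N → ∀ u, c ≤ u → ∀ j, ‖f l i u j‖ ≤ C

section

variable {a b : ℕ → ℝ} {N : ℕ} {R : ℝ}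

theorem isRowSystem_profile (hb : Encloses b N R) (ha : ∀ k, 1 ≤ k → |a k| < R)
    (hab : ∀ k i, 1 ≤ k → 1 ≤ i → a k * b i < 1) (m : ℕ) (H : ℕ → ℤ) (c : ℤ) :
    IsRowSystem N m (fun k i => a k * b i) c (profile a b m H R N) := by
  have hne : ∀ k i, 1 ≤ k → 1 ≤ i → 1 - (a k : ℂ) * b i ≠ 0 := fun k i hk hi h => by
    have h' : ((1 - a k * b i : ℝ) : ℂ) = 0 := by push_cast; exact h
    rw [Complex.ofReal_eq_zero] at h'
    linarith [hab k i hk hi]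
  have hcont : ∀ l (j : Fin N), ContinuousOn (testFun a b m H l (j + 1)) (Metric.sphere 0 R) :=
    fun l j => continuousOn_testFun hb (by omega) j.2 ha H
  refine ⟨fun l _ i h1 hi u => ?_, fun l hl i h1 hi u => ?_, ?_⟩
  · have hprod : ∏ k ∈ Finset.Ioc l m, (1 - (a k : ℂ) * b i) ≠ 0 :=
      Finset.prod_ne_zero_iff.2 fun k hk => hne k i (by rw [Finset.mem_Ioc] at hk; omega) h1
    -- The coefficient corrects for the different normalizations of rows `i` and `i + 1`. It does
    -- not depend on the column, as a row operation requires.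
    refine ⟨(∏ k ∈ Finset.Ioc l m, (1 - (a k : ℂ) * b (i + 1)))
      / (∏ k ∈ Finset.Ioc l m, (1 - (a k : ℂ) * b i))
      * ((b (i + 1) : ℂ) * ((b i : ℂ) / b (i + 1)) ^ u), ?_⟩
    ext j
    simp only [profile, Pi.add_apply, Pi.smul_apply, smul_eq_mul]
    rw [contourRow_sub_one hb h1 hi u (hcont l j)]
    generalize ((b i : ℂ) / b (i + 1)) ^ u = t
    generalize ∏ k ∈ Finset.Ioc l m, (1 - (a k : ℂ) * b i) = p at *
    generalize ∏ k ∈ Finset.Ioc l m, (1 - (a k : ℂ) * b (i + 1)) = p' at *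
    field_simp
  · ext j
    simp only [profile, Pi.sub_apply, Pi.smul_apply, smul_eq_mul]
    rw [← contourRow_geometric hb h1 hi u (a (l + 1)) (hcont l j) (fun z hz =>
      testFun_succ hl (ha _ (by omega)) H (by rw [mem_sphere_zero_iff_norm] at hz; exact hz.ge)),
      Ioc_eq_insert_succ hl, Finset.prod_insert (by simp)]
    push_cast
    ring
  · have hex : ∀ l i (j : Fin N), ∃ C, 1 ≤ i → i ≤ N →
        ∀ u, c ≤ u → ‖profile a b m H R N l i u j‖ ≤ C := fun l i j => by
      by_cases hi : 1 ≤ i ∧ i ≤ N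
      · obtain ⟨C, hC⟩ := exists_norm_contourRow_le hb hi.1 hi.2 c (hcont l j)
        refine ⟨‖(1 / (2 * (Real.pi : ℂ) * Complex.I))
          * (∏ k ∈ Finset.Ioc l m, (1 - (a k : ℂ) * b i))‖ * C, fun _ _ u hu => ?_⟩
        rw [profile, norm_mul]
        exact mul_le_mul_of_nonneg_left (hC u hu) (norm_nonneg _)
      · exact ⟨0, fun h1 h2 => absurd ⟨h1, h2⟩ hi⟩
    choose C hC using hex
    -- Only finitely many triples `(l, i, j)` occur, so the sum of their bounds is uniform.
    refine ⟨∑ l ∈ Finset.range (m + 1), ∑ i ∈ Finset.range (N + 1), ∑ j, |C l i j|,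
      fun l hl i h1 hi u hu j => (hC l i j h1 hi u hu).trans ((le_abs_self _).trans ?_)⟩
    calc |C l i j| ≤ ∑ j, |C l i j| :=
          Finset.single_le_sum (f := fun j => |C l i j|) (fun _ _ => abs_nonneg _)
            (Finset.mem_univ j)
      _ ≤ ∑ i ∈ Finset.range (N + 1), ∑ j, |C l i j| :=
          Finset.single_le_sum (f := fun i => ∑ j, |C l i j|)
            (fun _ _ => Finset.sum_nonneg fun _ _ => abs_nonneg _)
            (Finset.mem_range.2 (by omega))
      _ ≤ _ := Finset.single_le_sum (f := fun l => ∑ i ∈ Finset.range (N + 1), ∑ j, |C l i j|)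
            (fun _ _ => Finset.sum_nonneg fun _ _ => Finset.sum_nonneg fun _ _ => abs_nonneg _)
            (Finset.mem_range.2 (by omega))

/-! ### The determinant at the final and initial times -/

/-- A square matrix with a zero block of size `(N - r) × (r + 1)` is singular. -/
theorem det_eq_zero_of_zero_block {N : ℕ} (M : Matrix (Fin N) (Fin N) ℂ) (r : Fin N)
    (h : ∀ i j, r ≤ i → j ≤ r → M i j = 0) : M.det = 0 := by
  rw [Matrix.det_apply]
  refine Finset.sum_eq_zero fun σ _ => ?_
  obtain ⟨j, hj, hr⟩ : ∃ j, j ≤ r ∧ r ≤ σ j := by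
    by_contra! hcon
    -- Otherwise `σ` would inject the `r + 1` indices up to `r` into the `r` indices below `r`.
    have := Finset.card_le_card_of_injOn (s := Finset.Iic r) (t := Finset.Iio r) σ
      (fun j hj => by simpa using hcon j (by simpa using hj)) σ.injective.injOn
    simp at this
  rw [Finset.prod_eq_zero (f := fun i => M (σ i) i) (Finset.mem_univ j) (h _ _ hr hj), smul_zero]

/-- If every `x i < H i`, then `x i < H j` for `i ≤ j`, and the matrix is lower triangular with unit
diagonal. If `H r ≤ x r` for some `r`, then `H j ≤ H r ≤ x r ≤ x i` for `j ≤ r ≤ i`, which gives a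
zero block too large for an invertible matrix. -/
theorem det_profile_self (hb : Encloses b N R) (a : ℕ → ℝ) (m : ℕ) {H x : ℕ → ℤ}
    (hH : MonotoneOn H (Set.Icc 1 N)) (hx : MonotoneOn x (Set.Icc 1 N)) :
    (Matrix.of fun i j : Fin N => profile a b m H R N m (i + 1) (x (i + 1)) j).det
      = Set.indicator {y : ℕ → ℤ | ∀ i ∈ Set.Icc 1 N, y i < H i} (fun _ => (1 : ℂ)) x := by
  have hp : ∀ i j : Fin N, (Matrix.of fun i j : Fin N =>
      profile a b m H R N m (i + 1) (x (i + 1)) j) i j = 1 / (2 * (Real.pi : ℂ) * Complex.I)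
        * contourRow b R (testFun a b m H m (j + 1)) (i + 1) (x (i + 1)) := fun i j => by
    rw [Matrix.of_apply, profile, Finset.Ioc_self, Finset.prod_empty, mul_one]
  have mem : ∀ i : Fin N, (i : ℕ) + 1 ∈ Set.Icc 1 N := fun i => ⟨by omega, i.2⟩
  by_cases hlt : ∀ i ∈ Set.Icc 1 N, x i < H i
  · rw [Set.indicator_of_mem (by exact hlt), Matrix.det_of_isLowerTriangular]
    · refine Finset.prod_eq_one fun i _ => ?_
      rw [hp, contourRow_testFun_self hb a m (by omega) i.2 (hlt _ (mem i)),
        one_div_mul_cancel]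
      simp [Real.pi_ne_zero]
    · intro i j hij
      have hij' : i < j := hij
      rw [hp, contourRow_testFun_of_gt hb a m (by omega) (by simpa using hij') j.2, mul_zero]
      exact (hlt _ (mem i)).trans_le (hH (mem i) (mem j) (by simpa using hij'.le))
  · rw [Set.indicator_of_notMem (by exact hlt)]
    push Not at hlt
    obtain ⟨r, hr, hle⟩ := hlt
    have hr' : r - 1 < N := by have := hr.1; have := hr.2; omega
    have hr1 : r - 1 + 1 = r := Nat.sub_add_cancel hr.1
    refine det_eq_zero_of_zero_block _ ⟨r - 1, hr'⟩ fun i j hi hj => ?_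
    rw [Fin.le_def] at hi hj
    simp only at hi hj
    rw [hp, contourRow_testFun_of_le hb a m (by omega) (by omega) i.2, mul_zero]
    exact (hH (mem j) hr (by omega)).trans (hle.trans (hx hr (mem i) (by omega)))

/-- The factors `1 - a k * b` are attached to columns in `matrixF` and to rows in `profile`; both
contribute the same product to the determinant. -/
theorem det_matrixF_eq (hab : ∀ k i, 1 ≤ k → 1 ≤ i → a k * b i < 1) (m : ℕ) (H x : ℕ → ℤ) :
    (matrixF a b m N x H R).det
      = (Matrix.of fun i j : Fin N => profile a b m H R N 0 (i + 1) (x (i + 1)) j).det := by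
  have hIoc : Finset.Ioc 0 m = Finset.Icc 1 m := by
    ext k; simp only [Finset.mem_Ioc, Finset.mem_Icc]; omega
  set v : Fin N → ℂ := fun i => ∏ k ∈ Finset.Icc 1 m, (1 - (a k : ℂ) * b ((i : ℕ) + 1)) with hv
  have hv0 : ∏ i, v i ≠ 0 := by
    refine Finset.prod_ne_zero_iff.2 fun i _ => Finset.prod_ne_zero_iff.2 fun k hk h => ?_
    have h' : ((1 - a k * b ((i : ℕ) + 1) : ℝ) : ℂ) = 0 := by push_cast; exact h
    rw [Complex.ofReal_eq_zero] at h'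
    linarith [hab k (i + 1) (Finset.mem_Icc.1 hk).1 (by omega)]
  refine mul_left_cancel₀ hv0 ?_
  rw [← Matrix.det_mul_column, ← Matrix.det_mul_row]
  congr 1
  ext i j
  simp only [Matrix.of_apply, matrixF, entry, profile, hIoc, contourRow]
  have hint : ∮ z in C(0, R), integrand a b m x H (i + 1) (j + 1) z
      = v j * ∮ z in C(0, R), (z * (b (i + 1) : ℂ)) ^ (-x (i + 1)) /
        (∏ k ∈ Finset.Icc 1 ((i : ℕ) + 1), (z - 1 / (b k : ℂ))) * testFun a b m H 0 (j + 1) z := by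
    rw [← circleIntegral.integral_const_mul]
    congr 1
    ext z
    simp only [integrand, testFun, hIoc, hv, Finset.prod_mul_distrib, Finset.prod_inv_distrib,
      zpow_neg, div_eq_mul_inv]
    ring
  rw [hint]
  simp only [hv]
  ring

end

/-! ### The growth function and the update of one cell -/

section

variable {c : ℤ} {x : ℕ → ℤ} {N : ℕ}

theorem growth_congr {w w' : ℕ → ℕ → ℕ} (l n : ℕ)
    (h : ∀ i j, 1 ≤ i → i ≤ l → 1 ≤ j → j ≤ n → w i j = w' i j) :
    growth c x w l n = growth c x w' l n := by
  induction l generalizing n with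
  | zero => cases n <;> simp only [growth]
  | succ l ihl =>
    induction n with
    | zero => simp only [growth]
    | succ n ihn =>
      rw [growth, growth, ihl (n + 1) fun i j h1 h2 h3 h4 => h i j h1 (by omega) h3 h4,
        ihn fun i j h1 h2 h3 h4 => h i j h1 h2 h3 (by omega),
        h _ _ (by omega) le_rfl (by omega) le_rfl]

theorem le_growth (hx : MonotoneOn x (Set.Icc 1 N)) (hc : c ≤ x 1) (w : ℕ → ℕ → ℕ) (l : ℕ)
    {n : ℕ} (hn : n ≤ N) : c ≤ growth c x w l n := by
  induction l generalizing n with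
  | zero =>
    cases n with
    | zero => simp only [growth, le_refl]
    | succ n =>
      rw [growth]
      exact hc.trans (hx ⟨le_rfl, by omega⟩ ⟨by omega, hn⟩ (by omega))
  | succ l ih =>
    cases n with
    | zero => simp only [growth, le_refl]
    | succ n =>
      rw [growth]
      have := ih hn
      have := le_max_left (growth c x w l (n + 1)) (growth c x w (l + 1) n)
      omega

theorem monotoneOn_growth (hx : MonotoneOn x (Set.Icc 1 N)) (w : ℕ → ℕ → ℕ) (l : ℕ) :
    MonotoneOn (growth c x w l) (Set.Icc 1 N) := by
  cases l with
  | zero =>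
    intro i hi j hj hij
    obtain ⟨i, rfl⟩ := Nat.exists_eq_add_of_le' hi.1
    obtain ⟨j, rfl⟩ := Nat.exists_eq_add_of_le' hj.1
    rw [growth, growth]
    exact hx hi hj hij
  | succ l =>
    refine Monotone.monotoneOn (monotone_nat_of_le_succ fun n => ?_) _
    rw [growth]
    have := le_max_right (growth c x w l (n + 1)) (growth c x w (l + 1) n)
    omega

/-- The matrix with rows `f i (g i)` for `i ≤ n` and `s i (max u (y i))` for `i > n`
(with rows counted from `1`). -/
def stepMatrix (f s : ℕ → ℤ → Fin N → ℂ) (n : ℕ) (g y : ℕ → ℤ) (u : ℤ) :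
    Matrix (Fin N) (Fin N) ℂ :=
  Matrix.of fun i => if (i : ℕ) < n then f (i + 1) (g (i + 1)) else s (i + 1) (max u (y (i + 1)))

/-- Once row `n + 1` (from 1) is at `u + 1`, each later row still at `u` can be raised to `u + 1` by
subtracting a multiple of the row before it. As `y` is monotone, that predecessor is itself at `u +
1` in the raised matrix. -/
theorem det_stepMatrix_row_succ {f s : ℕ → ℤ → Fin N → ℂ} {n : ℕ} (hn : n < N) {g y : ℕ → ℤ}
    (hy : MonotoneOn y (Set.Icc 1 N)) (u : ℤ)
    (hs : ∀ i, 1 ≤ i → i + 1 ≤ N → ∀ u, ∃ r : ℂ, s (i + 1) (u - 1) = s (i + 1) u + r • s i u) :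
    ((stepMatrix f s n g y u).updateRow ⟨n, hn⟩ (s (n + 1) (u + 1))).det
      = ((stepMatrix f s n g y (u + 1)).updateRow ⟨n, hn⟩ (s (n + 1) (u + 1))).det := by
  obtain ⟨N, rfl⟩ := Nat.exists_eq_add_of_le' (Nat.zero_lt_of_lt hn)
  have key : ∀ i : Fin N, ∃ r : ℂ, ∀ j,
      (stepMatrix f s n g y (u + 1)).updateRow ⟨n, hn⟩ (s (n + 1) (u + 1)) i.succ j
        = (stepMatrix f s n g y u).updateRow ⟨n, hn⟩ (s (n + 1) (u + 1)) i.succ j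
          + r * (stepMatrix f s n g y (u + 1)).updateRow ⟨n, hn⟩ (s (n + 1) (u + 1)) i.castSucc j := by
    intro i
    rcases lt_trichotomy ((i : ℕ) + 1) n with hi | hi | hi
    · refine ⟨0, fun j => ?_⟩
      have hne : i.succ ≠ ⟨n, hn⟩ := by simp [Fin.ext_iff]; omega
      rw [Matrix.updateRow_ne hne, Matrix.updateRow_ne hne, zero_mul, add_zero]
      simp [stepMatrix, hi]
    · refine ⟨0, fun j => ?_⟩
      have he : i.succ = ⟨n, hn⟩ := by simp [Fin.ext_iff]; omega
      rw [he, Matrix.updateRow_self, Matrix.updateRow_self, zero_mul, add_zero]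
    · have hne : i.succ ≠ ⟨n, hn⟩ := by simp [Fin.ext_iff]; omega
      rw [Matrix.updateRow_ne hne, Matrix.updateRow_ne hne]
      have hlt : ¬ (i : ℕ) + 1 < n := by omega
      rcases le_or_gt (u + 1) (y (i + 1 + 1)) with hyu | hyu
      · refine ⟨0, fun j => ?_⟩
        simp [stepMatrix, hlt, max_eq_right hyu, max_eq_right (show u ≤ y (i + 1 + 1) by omega)]
      · obtain ⟨r, hr⟩ := hs (i + 1) (by omega) (by omega) (u + 1)
        have hrow : ∀ j, (stepMatrix f s n g y (u + 1)).updateRow ⟨n, hn⟩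
            (s (n + 1) (u + 1)) i.castSucc j = s (i + 1) (u + 1) j := by
          intro j
          rcases (show n ≤ (i : ℕ) by omega).eq_or_lt with he | hni
          · have he' : i.castSucc = ⟨n, hn⟩ := by simp [Fin.ext_iff]; omega
            rw [he', Matrix.updateRow_self, he]
          · have hne' : i.castSucc ≠ ⟨n, hn⟩ := by simp [Fin.ext_iff]; omega
            have hyi : y (i + 1) ≤ u + 1 :=
              (hy ⟨by omega, by omega⟩ ⟨by omega, by omega⟩ (Nat.le_succ _)).trans hyu.le
            rw [Matrix.updateRow_ne hne']
            simp [stepMatrix, hni.not_gt, max_eq_left hyi]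
        refine ⟨-r, fun j => ?_⟩
        rw [add_sub_cancel_right] at hr
        rw [hrow]
        simp [stepMatrix, hlt, max_eq_left hyu.le, max_eq_left (show y (i + 1 + 1) ≤ u by omega), hr]
  choose r hr using key
  refine (Matrix.det_eq_of_forall_row_eq_smul_add_pred r (fun j => ?_) hr).symm
  rcases Nat.eq_zero_or_pos n with rfl | hn0
  · have he : (0 : Fin (N + 1)) = ⟨0, hn⟩ := rfl
    rw [he, Matrix.updateRow_self, Matrix.updateRow_self]
  · have hne : (0 : Fin (N + 1)) ≠ ⟨n, hn⟩ := by simp [Fin.ext_iff]; omega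
    rw [Matrix.updateRow_ne hne, Matrix.updateRow_ne hne]
    simp [stepMatrix, hn0]

theorem norm_det_le {M : Matrix (Fin N) (Fin N) ℂ} {C : ℝ} (h : ∀ i j, ‖M i j‖ ≤ C) :
    ‖M.det‖ ≤ N.factorial * C ^ N := by
  have := Matrix.det_le (A := M) (abv := NormedField.toAbsoluteValue ℂ) h
  rwa [nsmul_eq_mul, Fintype.card_fin] at this

/-- Averaging a determinant over a geometric weight at one cell. -/
theorem hasSum_det_updateRow {f s : ℕ → ℤ → Fin N → ℂ} {n : ℕ} (hn : n < N) {g y : ℕ → ℤ}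
    (hy : MonotoneOn y (Set.Icc 1 N)) {q C : ℝ} (hq0 : 0 ≤ q) (hq1 : q < 1)
    (hg : ∀ i ≤ N, c ≤ g i)
    (hs : ∀ i, 1 ≤ i → i + 1 ≤ N → ∀ u, ∃ r : ℂ, s (i + 1) (u - 1) = s (i + 1) u + r • s i u)
    (hfs : ∀ u, s (n + 1) u - (q : ℂ) • s (n + 1) (u + 1) = (1 - (q : ℂ)) • f (n + 1) u)
    (hfC : ∀ i, 1 ≤ i → i ≤ N → ∀ u, c ≤ u → ∀ j, ‖f i u j‖ ≤ C)
    (hsC : ∀ i, 1 ≤ i → i ≤ N → ∀ u, c ≤ u → ∀ j, ‖s i u j‖ ≤ C) :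
    HasSum (fun k : ℕ => ((1 - q) * q ^ k : ℝ) *
      ((stepMatrix f s n g y (max (y (n + 1)) (g n) + k)).updateRow ⟨n, hn⟩
        (f (n + 1) (max (y (n + 1)) (g n) + k))).det)
      (stepMatrix f s n g y (g n)).det := by
  set w := max (y (n + 1)) (g n) with hw
  have hcw : c ≤ w := (hg n hn.le).trans (le_max_right _ _)
  set T : ℤ → ℂ := fun u =>
    ((stepMatrix f s n g y u).updateRow ⟨n, hn⟩ (s (n + 1) u)).det with hT
  have hTC : ∀ u, c ≤ u → ‖T u‖ ≤ N.factorial * C ^ N := fun u hu => by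
    refine norm_det_le fun i j => ?_
    by_cases hi : i = ⟨n, hn⟩
    · rw [hi, Matrix.updateRow_self]
      exact hsC _ (by omega) hn u hu j
    · rw [Matrix.updateRow_ne hi, stepMatrix, Matrix.of_apply]
      split_ifs with h
      · exact hfC _ (by omega) i.2 _ (hg _ i.2) j
      · exact hsC _ (by omega) i.2 _ (hu.trans (le_max_left _ _)) j
  have hstep : ∀ u, (1 - (q : ℂ)) * ((stepMatrix f s n g y u).updateRow ⟨n, hn⟩
      (f (n + 1) u)).det = T u - q * T (u + 1) := fun u => by
    rw [eq_sub_iff_add_eq]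
    simp only [hT]
    rw [← det_stepMatrix_row_succ hn hy u hs, ← Matrix.det_updateRow_smul,
      ← Matrix.det_updateRow_smul, ← Matrix.det_updateRow_add, ← hfs, sub_add_cancel]
  set F : ℕ → ℂ := fun k => (q : ℂ) ^ k * T (w + k) with hF
  have hsum : Summable F := by
    refine Summable.of_norm_bounded
      ((summable_geometric_of_lt_one hq0 hq1).mul_right (N.factorial * C ^ N)) fun k => ?_
    rw [hF, norm_mul, norm_pow, Complex.norm_real, Real.norm_of_nonneg hq0]
    exact mul_le_mul_of_nonneg_left (hTC _ (by omega)) (pow_nonneg hq0 _)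
  -- The weighted terms are `F k - F (k + 1)`, so the series telescopes to `F 0`.
  have htel := hsum.hasSum.sub ((hasSum_nat_add_iff' 1).2 hsum.hasSum)
  rw [Finset.sum_range_one, sub_sub_cancel] at htel
  have hF0 : F 0 = (stepMatrix f s n g y (g n)).det := by
    simp only [hF, pow_zero, one_mul, Nat.cast_zero, add_zero, hT]
    congr 1
    ext i j
    by_cases hi : i = ⟨n, hn⟩
    · subst hi
      rw [Matrix.updateRow_self]
      simp [stepMatrix, hw, max_comm]
    · rw [Matrix.updateRow_ne hi]
      simp only [stepMatrix, Matrix.of_apply]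
      split_ifs with h
      · rfl
      · have hni : n < (i : ℕ) := by
          have : (i : ℕ) ≠ n := fun h' => hi (Fin.ext h')
          exact lt_of_le_of_ne (not_lt.1 h) this.symm
        -- Monotonicity lets the later rows absorb `y (n + 1)`, so starting at `w` or at `g n` gives
        -- the same maximum.
        have : y (n + 1) ≤ y (i + 1) :=
          hy ⟨by omega, by omega⟩ ⟨by omega, by omega⟩ (by omega)
        rw [show max w (y (i + 1)) = max (g n) (y (i + 1)) by omega]
  rw [hF0] at htel
  refine htel.congr_fun fun k => ?_
  have := hstep (w + k)
  simp only [hF]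
  push_cast
  rw [mul_right_comm, this, ← add_assoc]
  ring

end

/-! ### Expectations and the martingale property -/

/-- Integrating out an independent `ℕ`-valued variable. -/
theorem integral_comp_eq_of_indepFun {Ω α : Type*} [MeasurableSpace Ω] {μ : Measure Ω}
    [IsProbabilityMeasure μ] [MeasurableSpace α] [Countable α] [MeasurableSingletonClass α]
    {Y : Ω → α} {Z : Ω → ℕ} (hY : Measurable Y) (hZ : Measurable Z) (hYZ : IndepFun Y Z μ)
    {φ : α → ℕ → ℂ} {ψ : α → ℂ} {C : ℝ} (hC : ∀ y k, ‖φ y k‖ ≤ C)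
    (hsum : ∀ y, HasSum (fun k => (μ.real {s | Z s = k} : ℂ) * φ y k) (ψ y)) :
    ∫ s, φ (Y s) (Z s) ∂μ = ∫ s, ψ (Y s) ∂μ := by
  have := Measure.isProbabilityMeasure_map (μ := μ) hY.aemeasurable
  have := Measure.isProbabilityMeasure_map (μ := μ) hZ.aemeasurable
  have hmap := (indepFun_iff_map_prod_eq_prod_map_map hY.aemeasurable hZ.aemeasurable).1 hYZ
  have hmeas : Measurable fun p : α × ℕ => φ p.1 p.2 := measurable_of_countable _
  calc ∫ s, φ (Y s) (Z s) ∂μ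
      = ∫ p, φ p.1 p.2 ∂(μ.map fun s => (Y s, Z s)) :=
        (integral_map (hY.prodMk hZ).aemeasurable hmeas.aestronglyMeasurable).symm
    _ = ∫ y, ∫ k, φ y k ∂(μ.map Z) ∂(μ.map Y) := by
        rw [hmap]
        exact integral_prod _ (Integrable.of_bound hmeas.aestronglyMeasurable C
          (Filter.Eventually.of_forall fun p => hC p.1 p.2))
    _ = ∫ y, ψ y ∂(μ.map Y) := by
        congr 1
        ext y
        rw [integral_countable (Integrable.of_bound
          (measurable_of_countable _).aestronglyMeasurable C
          (Filter.Eventually.of_forall fun k => hC y k)), ← (hsum y).tsum_eq]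
        congr 1
        ext k
        rw [map_measureReal_apply hZ (measurableSet_singleton k), Complex.real_smul]
        rfl
    _ = ∫ s, ψ (Y s) ∂μ :=
        integral_map hY.aemeasurable (measurable_of_countable _).aestronglyMeasurable

section

variable {c : ℤ} {x : ℕ → ℤ} {N : ℕ}

/-- The determinant attached to the environment `w` after the cells `(i, j)` with `i ≤ l`, and
the cells `(l + 1, j)` with `j ≤ n`, have been updated. -/
def cellDet (c : ℤ) (x : ℕ → ℤ) (f : ℕ → ℕ → ℤ → Fin N → ℂ) (l n : ℕ) (w : ℕ → ℕ → ℕ) : ℂ :=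
  (stepMatrix (f (l + 1)) (f l) n (growth c x w (l + 1)) (growth c x w l)
    (growth c x w (l + 1) n)).det

/-- The determinant attached to the environment `w` at time `l`. -/
def timeDet (c : ℤ) (x : ℕ → ℤ) (f : ℕ → ℕ → ℤ → Fin N → ℂ) (l : ℕ) (w : ℕ → ℕ → ℕ) : ℂ :=
  (Matrix.of fun i : Fin N => f l (i + 1) (growth c x w l (i + 1))).det

/-- The boundary value `c` lies below every `G(l, i)`, so the maximum with it changes nothing; hence
the choice of `c` is immaterial. -/
theorem cellDet_zero (hx : MonotoneOn x (Set.Icc 1 N)) (hc : c ≤ x 1)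
    (f : ℕ → ℕ → ℤ → Fin N → ℂ) (l : ℕ) (w : ℕ → ℕ → ℕ) :
    cellDet c x f l 0 w = timeDet c x f l w := by
  unfold cellDet timeDet stepMatrix
  congr 2
  ext i
  have := le_growth hx hc w l i.2
  rw [if_neg (Nat.not_lt_zero _), growth, max_eq_right this]

theorem cellDet_last (f : ℕ → ℕ → ℤ → Fin N → ℂ) (l : ℕ) (w : ℕ → ℕ → ℕ) :
    cellDet c x f l N w = timeDet c x f (l + 1) w := by
  unfold cellDet timeDet stepMatrix
  congr 2
  ext i
  rw [if_pos i.2]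

theorem cellDet_congr (f : ℕ → ℕ → ℤ → Fin N → ℂ) {l n : ℕ} {w w' : ℕ → ℕ → ℕ}
    (h : ∀ i j, 1 ≤ i → 1 ≤ j → (i ≤ l ∧ j ≤ N ∨ i ≤ l + 1 ∧ j ≤ n) → w i j = w' i j) :
    cellDet c x f l n w = cellDet c x f l n w' := by
  have h1 : ∀ k ≤ n, growth c x w (l + 1) k = growth c x w' (l + 1) k := fun k hk =>
    growth_congr _ _ fun i j hi hil hj hjk => h i j hi hj (Or.inr ⟨hil, hjk.trans hk⟩)
  have h2 : ∀ k ≤ N, growth c x w l k = growth c x w' l k := fun k hk =>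
    growth_congr _ _ fun i j hi hil hj hjk => h i j hi hj (Or.inl ⟨hil, hjk.trans hk⟩)
  unfold cellDet stepMatrix
  congr 2
  ext i
  rw [h1 n le_rfl, h2 _ i.2]
  split_ifs with hi
  · rw [h1 _ hi]
  · rfl

theorem cellDet_succ (f : ℕ → ℕ → ℤ → Fin N → ℂ) {l n : ℕ} (hn : n < N) (w : ℕ → ℕ → ℕ) :
    cellDet c x f l (n + 1) w
      = ((stepMatrix (f (l + 1)) (f l) n (growth c x w (l + 1)) (growth c x w l)
          (growth c x w (l + 1) (n + 1))).updateRow ⟨n, hn⟩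
            (f (l + 1) (n + 1) (growth c x w (l + 1) (n + 1)))).det := by
  unfold cellDet
  congr 1
  ext i j
  by_cases hi : i = ⟨n, hn⟩
  · subst hi
    rw [Matrix.updateRow_self]
    simp [stepMatrix]
  · have hne : (i : ℕ) ≠ n := fun h' => hi (Fin.ext h')
    rw [Matrix.updateRow_ne hi]
    simp only [stepMatrix, Matrix.of_apply]
    by_cases h : (i : ℕ) < n
    · rw [if_pos h, if_pos (by omega)]
    · rw [if_neg h, if_neg (by omega)]

variable {m : ℕ} {q : ℕ → ℕ → ℝ} {f : ℕ → ℕ → ℤ → Fin N → ℂ}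

theorem IsRowSystem.exists_norm_cellDet_le (hf : IsRowSystem N m q c f)
    (hx : MonotoneOn x (Set.Icc 1 N)) (hc : c ≤ x 1) {l n : ℕ} (hl : l < m) (hn : n ≤ N) :
    ∃ C, ∀ w, ‖cellDet c x f l n w‖ ≤ C := by
  obtain ⟨C, hC⟩ := hf.bounded
  refine ⟨N.factorial * C ^ N, fun w => norm_det_le fun i j => ?_⟩
  rw [stepMatrix, Matrix.of_apply]
  split_ifs with h
  · exact hC _ hl _ (by omega) i.2 _ (le_growth hx hc w _ i.2) j
  · exact hC _ hl.le _ (by omega) i.2 _ ((le_growth hx hc w _ hn).trans (le_max_left _ _)) j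

theorem IsRowSystem.hasSum_cellDet (hf : IsRowSystem N m q c f)
    (hx : MonotoneOn x (Set.Icc 1 N)) (hc : c ≤ x 1) {l n : ℕ} (hl : l < m) (hn : n < N)
    (hq0 : 0 ≤ q (l + 1) (n + 1)) (hq1 : q (l + 1) (n + 1) < 1) (w : ℕ → ℕ → ℕ)
    (w' : ℕ → ℕ → ℕ → ℕ) (hw : ∀ k i j, (i, j) ≠ (l + 1, n + 1) → w' k i j = w i j)
    (hw' : ∀ k, w' k (l + 1) (n + 1) = k) :
    HasSum (fun k : ℕ => ((1 - q (l + 1) (n + 1)) * q (l + 1) (n + 1) ^ k : ℝ) *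
      cellDet c x f l (n + 1) (w' k)) (cellDet c x f l n w) := by
  obtain ⟨C, hC⟩ := hf.bounded
  have h := hasSum_det_updateRow (c := c) (f := f (l + 1)) (s := f l) hn
    (g := growth c x w (l + 1)) (monotoneOn_growth (c := c) hx w l) hq0 hq1
    (fun i hi => le_growth hx hc w _ hi) (hf.sub_one l hl.le)
    (hf.geometric l hl (n + 1) (by omega) hn) (hC (l + 1) hl) (hC l hl.le)
  refine h.congr_fun fun k => ?_
  have h1 : ∀ i ≤ n, growth c x (w' k) (l + 1) i = growth c x w (l + 1) i := fun i hi =>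
    growth_congr _ _ fun i' j _ _ _ hj => hw k i' j (by simp; omega)
  have h2 : ∀ i, growth c x (w' k) l i = growth c x w l i := fun i =>
    growth_congr _ _ fun i' j _ hi' _ _ => hw k i' j (by simp; omega)
  have h3 : growth c x (w' k) (l + 1) (n + 1)
      = max (growth c x w l (n + 1)) (growth c x w (l + 1) n) + k := by
    rw [growth, h2, h1 n le_rfl, hw']
  rw [cellDet_succ f hn, h3]
  congr 3
  unfold stepMatrix
  congr 1
  ext i
  rw [h2]
  split_ifs with hi
  · rw [h1 _ hi]
  · rfl

section

variable {Ω : Type*} [MeasurableSpace Ω] {μ : Measure Ω}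
  {a b : ℕ → ℝ} {ω : ℕ → ℕ → Ω → ℕ}

/-- The determinant reads only finitely many weights. Conditioning on those other than the current
one leaves a countable state space and an independent geometric variable. -/
theorem IsRowSystem.integral_cellDet_succ [IsProbabilityMeasure μ]
    (hω : IsGeometricEnvironment μ a b ω)
    (hab : AdmissibleRates a b) (hf : IsRowSystem N m (fun k i => a k * b i) c f)
    (hx : MonotoneOn x (Set.Icc 1 N)) (hc : c ≤ x 1) {l n : ℕ} (hl : l < m) (hn : n < N) :
    ∫ s, cellDet c x f l (n + 1) (fun i j => ω i j s) ∂μ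
      = ∫ s, cellDet c x f l n (fun i j => ω i j s) ∂μ := by
  set p : ℕ+ × ℕ+ := (l.succPNat, n.succPNat) with hp
  set S : Finset (ℕ+ × ℕ+) := (Finset.Iic ((l + 1).succPNat, N.succPNat)).erase p with hS
  have hmeas : ∀ r : ℕ+ × ℕ+, Measurable (ω (r.1 : ℕ) (r.2 : ℕ)) := fun r =>
    hω.measurable _ _ r.1.pos r.2.pos
  have hind := hω.indep.indepFun_finset S {p} (by simp [hS]) hmeas
  have hind' : IndepFun (fun s (r : S) => ω (r.1.1 : ℕ) (r.1.2 : ℕ) s) (ω (l + 1) (n + 1)) μ :=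
    hind.comp (φ := id) (ψ := fun v : ({p} : Finset (ℕ+ × ℕ+)) → ℕ => v ⟨p, by simp⟩)
      measurable_id (measurable_pi_apply _)
  -- Rebuilds an array from the conditioned weights `v` and the current weight `k`. The default 0 is
  -- never read by the determinants below.
  set W : (S → ℕ) → ℕ → ℕ → ℕ → ℕ := fun v k i j =>
    if (i, j) = (l + 1, n + 1) then k
    else if h : (i.toPNat', j.toPNat') ∈ S then v ⟨_, h⟩ else 0 with hW
  have hWω : ∀ s k i j, 1 ≤ i → 1 ≤ j → i ≤ l + 1 → j ≤ N → (i, j) ≠ (l + 1, n + 1) →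
      W (fun r : S => ω (r.1.1 : ℕ) (r.1.2 : ℕ) s) k i j = ω i j s := by
    intro s k i j hi hj hil hjN hne
    have hi' : (i.toPNat' : ℕ) = i := by rw [Nat.toPNat'_coe, if_pos (by omega)]
    have hj' : (j.toPNat' : ℕ) = j := by rw [Nat.toPNat'_coe, if_pos (by omega)]
    have hmem : (i.toPNat', j.toPNat') ∈ S := by
      rw [hS, Finset.mem_erase, Finset.mem_Iic, Prod.le_def]
      refine ⟨fun h => hne ?_, ?_, ?_⟩
      · rw [hp, Prod.mk.injEq, ← PNat.coe_inj, ← PNat.coe_inj, hi', hj'] at h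
        simpa using h
      · rw [← PNat.coe_le_coe]; simp only [hi', Nat.succPNat_coe]; omega
      · rw [← PNat.coe_le_coe]; simp only [hj', Nat.succPNat_coe]; omega
    simp only [hW]
    rw [if_neg hne, dif_pos hmem]
    simp only [hi', hj']
  obtain ⟨C, hC⟩ := hf.exists_norm_cellDet_le hx hc hl hn
  have key := integral_comp_eq_of_indepFun (μ := μ)
    (measurable_pi_lambda _ fun r : S => hmeas r.1)
    (hω.measurable (l + 1) (n + 1) (by omega) (by omega)) hind'
    -- Before the update the current weight is not read, so 0 can stand in for it in `ψ`.
    (φ := fun v k => cellDet c x f l (n + 1) (W v k)) (ψ := fun v => cellDet c x f l n (W v 0))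
    (C := C) (fun v k => hC _) (fun v => by
      have := hf.hasSum_cellDet hx hc hl hn (hab.pos _ _ (by omega) (by omega)).le
        (hab.lt_one _ _ (by omega) (by omega)) (W v 0) (W v)
        (fun k i j hne => by simp only [hW]; rw [if_neg hne, if_neg hne])
        (fun k => if_pos rfl)
      refine this.congr_fun fun k => ?_
      rw [hω.law _ _ (by omega) (by omega)])
  calc _ = _ := integral_congr_ae (Filter.Eventually.of_forall fun s => ?_)
    _ = _ := key
    _ = _ := integral_congr_ae (Filter.Eventually.of_forall fun s => ?_)
  · refine cellDet_congr f fun i j hi hj hij => ?_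
    by_cases h : (i, j) = (l + 1, n + 1)
    · simp only [hW]
      rw [if_pos h]
      simp only [Prod.mk.injEq] at h
      rw [h.1, h.2]
    · exact (hWω s _ i j hi hj (by omega) (by omega) h).symm
  · exact cellDet_congr f fun i j hi hj hij =>
      hWω s _ i j hi hj (by omega) (by omega) (by simp; omega)

/-- The expected determinant does not change in time. -/
theorem IsRowSystem.integral_timeDet [IsProbabilityMeasure μ]
    (hω : IsGeometricEnvironment μ a b ω)
    (hab : AdmissibleRates a b) (hf : IsRowSystem N m (fun k i => a k * b i) c f)
    (hx : MonotoneOn x (Set.Icc 1 N)) (hc : c ≤ x 1) {l : ℕ} (hl : l ≤ m) :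
    ∫ s, timeDet c x f l (fun i j => ω i j s) ∂μ
      = (Matrix.of fun i : Fin N => f 0 (i + 1) (x (i + 1))).det := by
  induction l with
  | zero => simp [timeDet, growth]
  | succ l ih =>
    have hrow : ∀ n ≤ N, ∫ s, cellDet c x f l n (fun i j => ω i j s) ∂μ
        = ∫ s, cellDet c x f l 0 (fun i j => ω i j s) ∂μ := fun n hn => by
      induction n with
      | zero => rfl
      | succ n ihn => rw [hf.integral_cellDet_succ hω hab hx hc hl hn, ihn (by omega)]
    simp only [← cellDet_last, hrow N le_rfl, cellDet_zero hx hc]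
    exact ih (by omega)

theorem measurable_growth (hω : IsGeometricEnvironment μ a b ω) (l n : ℕ) :
    Measurable fun s => growth c x (fun i j => ω i j s) l n := by
  induction l generalizing n with
  | zero => cases n <;> simp only [growth] <;> exact measurable_const
  | succ l ihl =>
    induction n with
    | zero => simp only [growth]; exact measurable_const
    | succ n ihn =>
      simp only [growth]
      exact ((ihl _).max ihn).add
        ((measurable_from_nat (f := fun k : ℕ => (k : ℤ))).comp
          (hω.measurable _ _ (by omega) (by omega)))

end

end

/-! ### Block heights -/

section

variable {p : ℕ} {n : Fin (p + 1) → ℕ} {h : Fin p → ℤ}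

theorem blockHeight_eq (hn : StrictMono n) {k : Fin p} {j : ℕ} (h1 : n k.castSucc < j)
    (h2 : j ≤ n k.succ) : blockHeight n h j = h k := by
  unfold blockHeight
  rw [Finset.sum_eq_single k, if_pos ⟨h1, h2⟩]
  · intro k' _ hne
    refine if_neg fun hk' => hne ?_
    rcases lt_trichotomy k' k with hlt | heq | hlt
    · have := hn.monotone (show k'.succ ≤ k.castSucc from hlt)
      omega
    · exact heq
    · have := hn.monotone (show k.succ ≤ k'.castSucc from hlt)
      omega
  · simp

theorem exists_block (hn0 : n 0 = 0) {j : ℕ} (h1 : 1 ≤ j) (h2 : j ≤ n (Fin.last p)) :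
    ∃ k : Fin p, n k.castSucc < j ∧ j ≤ n k.succ := by
  by_contra! hcon
  have : ∀ k : Fin (p + 1), n k < j := fun k => by
    induction k using Fin.induction with
    | zero => omega
    | succ k ih => exact hcon k ih
  exact (this _).not_ge h2

theorem monotoneOn_blockHeight (hn : StrictMono n) (hn0 : n 0 = 0) (hh : Monotone h) :
    MonotoneOn (blockHeight n h) (Set.Icc 1 (n (Fin.last p))) := by
  intro i hi j hj hij
  obtain ⟨k, hk1, hk2⟩ := exists_block hn0 hi.1 hi.2
  obtain ⟨k', hk1', hk2'⟩ := exists_block hn0 hj.1 hj.2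
  rw [blockHeight_eq hn hk1 hk2, blockHeight_eq hn hk1' hk2']
  refine hh (not_lt.1 fun hlt => ?_)
  have := hn.monotone (show k'.succ ≤ k.castSucc from hlt)
  omega

/-- On a block the height is constant and `g` is largest at the right end, so the condition there
implies it throughout the block. -/
theorem forall_lt_block_iff (hn : StrictMono n) (hn0 : n 0 = 0) {g : ℕ → ℤ}
    (hg : MonotoneOn g (Set.Icc 1 (n (Fin.last p)))) :
    (∀ k : Fin p, g (n k.succ) < h k)
      ↔ ∀ j ∈ Set.Icc 1 (n (Fin.last p)), g j < blockHeight n h j := by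
  constructor
  · intro H j hj
    obtain ⟨k, hk1, hk2⟩ := exists_block hn0 hj.1 hj.2
    rw [blockHeight_eq hn hk1 hk2]
    exact (hg hj ⟨hj.1.trans hk2, hn.monotone (Fin.le_last _)⟩ hk2).trans_lt (H k)
  · intro H k
    have hk : n k.castSucc < n k.succ := hn Fin.castSucc_lt_succ
    rw [← blockHeight_eq (h := h) hn hk le_rfl]
    exact H _ ⟨by omega, hn.monotone (Fin.le_last _)⟩

end

end PNG

/-! ### The determinantal formula -/

theorem theorem2 {Ω : Type*} [MeasurableSpace Ω] (μ : Measure Ω) [IsProbabilityMeasure μ]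
    (a b : ℕ → ℝ) (hab : PNG.AdmissibleRates a b)
    (ω : ℕ → ℕ → Ω → ℕ) (hω : PNG.IsGeometricEnvironment μ a b ω)
    (m N : ℕ) (x : ℕ → ℤ) (hx : MonotoneOn x (Set.Icc 1 N))
    (c : ℤ) (hc : c ≤ x 1)
    (p : ℕ) (n : Fin (p + 1) → ℕ) (hn : StrictMono n) (hn0 : n 0 = 0) (hnp : n (Fin.last p) = N)
    (h : Fin p → ℤ) (hh : Monotone h)
    (R : ℝ) (hR : ∀ j ∈ Finset.Icc 1 N, 1 / b j < R) :
    ((μ.real {s | ∀ k : Fin p,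
        PNG.growth c x (fun i j => ω i j s) m (n k.succ) < h k} : ℝ) : ℂ)
      = (PNG.matrixF a b m N x (PNG.blockHeight n h) R).det := by
  subst hnp
  set N := n (Fin.last p)
  have hb0 : ∀ k, 1 ≤ k → 0 < b k := fun k hk =>
    (hab.b_mem k hk).1.lt_of_ne fun h0 => by
      have := hab.pos 1 k le_rfl hk
      rw [← h0, mul_zero] at this
      exact this.false
  rcases Nat.eq_zero_or_pos N with hN | hN
  -- For `N = 0` strict monotonicity leaves no blocks: the event is certain and the empty
  -- determinant is 1.
  · obtain rfl : p = 0 := by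
      by_contra hp
      have hlt : n 0 < n (Fin.last p) := hn (Fin.pos_iff_ne_zero.2 (by simpa [Fin.ext_iff] using hp))
      omega
    have : IsEmpty (Fin N) := by rw [hN]; infer_instance
    rw [Matrix.det_isEmpty]
    simp
  have hb : PNG.Encloses b N R := by
    refine ⟨?_, fun k h1 _ => hb0 k h1, fun k h1 hk => hR k (Finset.mem_Icc.2 ⟨h1, hk⟩)⟩
    exact (one_div_pos.2 (hb0 1 le_rfl)).trans (hR 1 (Finset.mem_Icc.2 ⟨le_rfl, hN⟩))
  -- From `a k * b 1 < 1` follows `a k < 1 / b 1 < R`, so the poles at `a k` also lie inside the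
  -- contour.
  have ha : ∀ k, 1 ≤ k → |a k| < R := fun k hk => by
    rw [abs_of_nonneg (hab.a_mem k hk).1]
    have h1 := hR 1 (Finset.mem_Icc.2 ⟨le_rfl, hN⟩)
    refine lt_trans ?_ h1
    rw [lt_div_iff₀ (hb0 1 le_rfl)]
    exact hab.lt_one k 1 hk le_rfl
  have hH := PNG.monotoneOn_blockHeight hn hn0 hh
  have hE : ∀ s, PNG.timeDet c x (PNG.profile a b m (PNG.blockHeight n h) R N) m
      (fun i j => ω i j s) = Set.indicator {s | ∀ k : Fin p,
        PNG.growth c x (fun i j => ω i j s) m (n k.succ) < h k} (fun _ => (1 : ℂ)) s := fun s => by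
    have hg := PNG.monotoneOn_growth (c := c) hx (fun i j => ω i j s) m
    refine (PNG.det_profile_self hb a m hH hg).trans ?_
    by_cases hs : ∀ k : Fin p, PNG.growth c x (fun i j => ω i j s) m (n k.succ) < h k
    · rw [Set.indicator_of_mem (by exact (PNG.forall_lt_block_iff hn hn0 hg).1 hs),
        Set.indicator_of_mem (by exact hs)]
    · rw [Set.indicator_of_notMem
          (by exact fun H => hs ((PNG.forall_lt_block_iff hn hn0 hg).2 H)),
        Set.indicator_of_notMem (by exact hs)]
  have hmeas : MeasurableSet {s | ∀ k : Fin p,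
      PNG.growth c x (fun i j => ω i j s) m (n k.succ) < h k} := by
    rw [Set.ofPred_forall]
    exact MeasurableSet.iInter fun k =>
      measurableSet_lt (PNG.measurable_growth hω m _) measurable_const
  have hint := (PNG.isRowSystem_profile hb ha hab.lt_one m (PNG.blockHeight n h) c).integral_timeDet
    hω hab hx hc le_rfl
  simp only [hE] at hint
  rw [integral_indicator_const _ hmeas, Complex.real_smul, mul_one] at hint
  rw [hint, PNG.det_matrixF_eq hab.lt_one]
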